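/- A semiring is a non-empty set $S$ with two associative binary operations $+$ and $\cdot$ such that $+$ is commutative and $\cdot$ distributes over $+$ from both sides (neither a zero nor a unity is required). A subsemiring is a non-empty subset closed under both operations. A congruence on a semiring is an equivalence relation preserved under both operations, and a semiring is congruence-simple if it has exactly two congruences. Put $SS=\{ab : a,b\in S\}$. An element $w\in S$ is bi-absorbing if $aw=wa=w$ and $a+w=w$ for every $a\in S$. Let $\mathbf{M}_n(S)$ denote the semiring of all $n\times n$ matrices over $S$ with the usual addition and multiplication, let $L_2(\vee,\wedge)$ denote the two-element lattice $\{0<1\}$ with the join as addition and the meet as multiplication, and let $\mathbb{R}(\max,+)$ denote the semiring on the set $\mathbb{R}$ of real numbers with the maximum as addition and the usual sum as multiplication. **Theorem.** Let $S$ be a commutative semiring with $a+a=a$ for every $a\in S$, and let $n\geq 2$. Then the following conditions are equivalent: (i) $\mathbf{M}_n(S)$ is congruence-simple. (ii) $S$ is congruence-simple, $|SS|\neq 1$ and $S$ has no bi-absorbing element. (iii) $S$ is isomorphic either to $L_2(\vee,\wedge)$ or to a subsemiring $A$ of $\mathbb{R}(\max,+)$ that contains a (strictly) positive real number and a (strictly)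 negative real number. -/

import Mathlib

open scoped Pointwise

/-! Semirings here are non-empty sets with a commutative associative addition and an associative
multiplication that distributes over it on both sides. Neither a zero nor a unity is required, so
they are given by the classes `AddCommSemigroup`, `Semigroup` (or `CommSemigroup`),
`LeftDistribClass` and `RightDistribClass`. -/

/-- A semiring is congruence-simple if it has exactly two congruences. -/
def CongruenceSimple (R : Type*) [Add R] [Mul R] : Prop :=
  Nat.card (RingCon R) = 2

/-- `w` is bi-absorbing if it is multiplicatively absorbing (on both sides) and `a + w = w`
for every `a`. -/
def IsBiAbsorbing {R : Type*} [Add R] [Mul R] (w : R) : Prop :=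
  (∀ a : R, a * w = w) ∧ (∀ a : R, w * a = w) ∧ ∀ a : R, a + w = w

section Sum

/-- The sum of a non-empty finite family, computed in `S` with a new zero adjoined, is not the
adjoined zero. -/
theorem sum_coe_withZero_ne_zero {S : Type*} [AddCommSemigroup S] {ι : Type*} [Fintype ι]
    [Nonempty ι] (f : ι → S) : (∑ i, (f i : WithZero S)) ≠ 0 := by
  classical
  have key : ∀ s : Finset ι, s.Nonempty → ∃ a : S, (∑ i ∈ s, (f i : WithZero S)) = a := by
    intro s hs
    induction hs using Finset.Nonempty.cons_induction with
    | singleton i => exact ⟨f i, by simp⟩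
    | cons i s hi _ ih =>
      obtain ⟨a, ha⟩ := ih
      exact ⟨f i + a, by rw [Finset.sum_cons, ha, WithZero.coe_add]⟩
  obtain ⟨a, ha⟩ := key Finset.univ Finset.univ_nonempty
  rw [ha]
  exact WithZero.coe_ne_zero

/-- The sum of a non-empty finite family in a commutative additive semigroup. -/
noncomputable def nonemptySum {S : Type*} [AddCommSemigroup S] {ι : Type*} [Fintype ι]
    [Nonempty ι] (f : ι → S) : S :=
  WithZero.unzero (sum_coe_withZero_ne_zero f)

theorem coe_nonemptySum {S : Type*} [AddCommSemigroup S] {ι : Type*} [Fintype ι]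
    [Nonempty ι] (f : ι → S) : ((nonemptySum f : S) : WithZero S) = ∑ i, (f i : WithZero S) :=
  WithZero.coe_unzero _

theorem nonemptySum_fin_one {S : Type*} [AddCommSemigroup S] (f : Fin 1 → S) :
    nonemptySum f = f 0 := by
  apply WithZero.coe_injective
  rw [coe_nonemptySum, Fin.sum_univ_one]

theorem nonemptySum_fin_succ {S : Type*} [AddCommSemigroup S] {n : ℕ} [NeZero n]
    (f : Fin (n + 1) → S) :
    nonemptySum f = nonemptySum (fun i : Fin n => f i.castSucc) + f (Fin.last n) := by
  apply WithZero.coe_injective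
  rw [WithZero.coe_add, coe_nonemptySum, coe_nonemptySum, Fin.sum_univ_castSucc]

end Sum

/-- The `n × n` matrices over `S`. This is a type of its own because the product of Mathlib's
matrices needs a zero in `S`. -/
def MatrixSemiring (n : ℕ) (S : Type*) : Type _ := Fin n → Fin n → S

namespace MatrixSemiring

instance {n : ℕ} {S : Type*} [Add S] : Add (MatrixSemiring n S) :=
  ⟨fun A B i j => A i j + B i j⟩

noncomputable instance {n : ℕ} [NeZero n] {S : Type*} [AddCommSemigroup S] [Mul S] :
    Mul (MatrixSemiring n S) :=
  ⟨fun A B i j => nonemptySum fun k => A i k * B k j⟩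

end MatrixSemiring

/-- The two-element lattice `{0 < 1}` as a semiring: addition is the join, multiplication is the
meet. -/
def TwoLattice : Type := Bool

namespace TwoLattice

instance : Add TwoLattice := ⟨fun a b => max (α := Bool) a b⟩

instance : Mul TwoLattice := ⟨fun a b => min (α := Bool) a b⟩

end TwoLattice

/-- The max-plus semiring on the real numbers (without `-∞`): since the order is reversed, the
tropical addition is the maximum. -/
abbrev MaxPlus : Type := Tropical ℝᵒᵈ

namespace MaxPlus

/-- The real number underlying an element of the max-plus semiring. -/
def toReal (x : MaxPlus) : ℝ := OrderDual.ofDual (Tropical.untrop x)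

theorem toReal_add (x y : MaxPlus) : (x + y).toReal = max x.toReal y.toReal := rfl

theorem toReal_mul (x y : MaxPlus) : (x * y).toReal = x.toReal + y.toReal := rfl

end MaxPlus

/-- A subsemiring: a non-empty subset closed under addition and multiplication. -/
structure PlainSubsemiring (R : Type*) [Add R] [Mul R] extends
    AddSubsemigroup R, Subsemigroup R where
  nonempty' : carrier.Nonempty

namespace PlainSubsemiring

instance {R : Type*} [Add R] [Mul R] : SetLike (PlainSubsemiring R) R where
  coe A := A.carrier
  coe_injective A B h := by
    obtain ⟨⟨A, hA⟩, hA', hA''⟩ := A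
    obtain ⟨⟨B, hB⟩, hB', hB''⟩ := B
    congr

instance {R : Type*} [Add R] [Mul R] : AddMemClass (PlainSubsemiring R) R where
  add_mem {A} := A.add_mem'

instance {R : Type*} [Add R] [Mul R] : MulMemClass (PlainSubsemiring R) R where
  mul_mem {A} := A.mul_mem'

end PlainSubsemiring

/-! The sum of an idempotent semiring is the join of its natural order, and a congruence relates
all elements between two related ones. Multiplying a matrix on both sides by matrices that are
very small outside one column or row isolates one of its entries and spreads it over a constant
matrix. Hence a nontrivial congruence of the matrix semiring restricts to a nontrivial congruence
of `S`, identified with the constant matrices, which is total if `S` is congruence-simple.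

If some multiplication `x ↦ a * x` of a congruence-simple `S` is not injective, it is constant, and
`a * a` is a zero. Being or not being this zero is then a congruence, so that `S` has two elements.
Otherwise `S` embeds into its group of fractions, an ordered group in which `S` keeps its joins. The
cosets of the convex subgroup generated by `b / a`, where `a < b`, induce a congruence of `S`,
which is total by simplicity. Therefore the powers of `b / a` dominate every element. For
`b / a = (x ⊔ y) / y` this yields `y ≤ x`, so the order is total, and it is archimedean; Hölder's
theorem embeds the group into the real numbers. -/

section CongruenceSimple

variable {R : Type*} [Add R] [Mul R]

theorem congruenceSimple_iff_forall_rel :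
    CongruenceSimple R ↔
      Nontrivial R ∧ ∀ (c : RingCon R) {a b : R}, a ≠ b → c a b → ∀ x y, c x y := by
  constructor
  · intro h
    have hnt : Nontrivial R := by
      by_contra hR
      rw [not_nontrivial_iff_subsingleton] at hR
      have : Nat.card (RingCon R) = 1 := Nat.card_unique
      exact absurd (h.symm.trans this) (by norm_num)
    refine ⟨hnt, fun c a b hab hc x y => ?_⟩
    obtain ⟨d, -, hd⟩ := (Nat.card_eq_two_iff' (⊥ : RingCon R)).1 h
    have hc_top : c = ⊤ := (hd c (by rintro rfl; exact hab hc)).trans (hd ⊤ top_ne_bot).symm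
    rw [hc_top]
    trivial
  · rintro ⟨hnt, h⟩
    refine (Nat.card_eq_two_iff' (⊥ : RingCon R)).2 ⟨⊤, top_ne_bot, fun c hc => ?_⟩
    obtain ⟨a, b, hc_rel, hab⟩ : ∃ a b, c a b ∧ a ≠ b := by
      by_contra! h_eq
      exact hc (le_bot_iff.1 fun _ _ => h_eq _ _)
    exact top_le_iff.1 fun x y _ => h c hab hc_rel x y

theorem CongruenceSimple.nontrivial (hR : CongruenceSimple R) : Nontrivial R :=
  (congruenceSimple_iff_forall_rel.1 hR).1

theorem CongruenceSimple.rel_of_ne (hR : CongruenceSimple R) (c : RingCon R) {a b : R}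
    (hab : a ≠ b) (hc : c a b) (x y : R) : c x y :=
  (congruenceSimple_iff_forall_rel.1 hR).2 c hab hc x y

theorem congruenceSimple_of_card_eq_two (h : Nat.card R = 2) : CongruenceSimple R := by
  have hfin : Finite R := Nat.finite_of_card_ne_zero (by omega)
  refine congruenceSimple_iff_forall_rel.2
    ⟨Finite.one_lt_card_iff_nontrivial.1 (by omega), fun c a b hab hc => ?_⟩
  obtain ⟨b', -, hb'⟩ := (Nat.card_eq_two_iff' a).1 h
  have hrel_a (x : R) : c a x := by
    by_cases hx : x = a
    · exact hx ▸ c.refl a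
    · rwa [hb' x hx, ← hb' b hab.symm]
  exact fun x y => c.trans (c.symm (hrel_a x)) (hrel_a y)

end CongruenceSimple

section BiIdeal

/-- A bi-ideal of a semiring: a subset that absorbs both addition and multiplication. -/
structure IsBiIdeal {R : Type*} [Add R] [Mul R] (I : Set R) : Prop where
  add_mem_right : ∀ {x}, x ∈ I → ∀ z, x + z ∈ I
  mul_mem_right : ∀ {x}, x ∈ I → ∀ z, x * z ∈ I
  mul_mem_left : ∀ {x}, x ∈ I → ∀ z, z * x ∈ I

variable {R : Type*} [AddCommMagma R] [Mul R] {I : Set R}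

/-- The Rees congruence of a bi-ideal, which collapses the bi-ideal to a single class and keeps
all other elements apart. -/
def IsBiIdeal.reesCon (hI : IsBiIdeal I) : RingCon R where
  r x y := x = y ∨ x ∈ I ∧ y ∈ I
  iseqv :=
    { refl := fun _ => Or.inl rfl
      symm := fun h => h.imp Eq.symm And.symm
      trans := by
        rintro x y z (rfl | h) (rfl | h')
        exacts [Or.inl rfl, Or.inr h', Or.inr h, Or.inr ⟨h.1, h'.2⟩] }
  add' := by
    rintro x y z w (rfl | h) (rfl | h')
    · exact Or.inl rfl
    · rw [add_comm x z, add_comm x w]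
      exact Or.inr ⟨hI.add_mem_right h'.1 x, hI.add_mem_right h'.2 x⟩
    all_goals exact Or.inr ⟨hI.add_mem_right h.1 _, hI.add_mem_right h.2 _⟩
  mul' := by
    rintro x y z w (rfl | h) (rfl | h')
    · exact Or.inl rfl
    · exact Or.inr ⟨hI.mul_mem_left h'.1 x, hI.mul_mem_left h'.2 x⟩
    all_goals exact Or.inr ⟨hI.mul_mem_right h.1 _, hI.mul_mem_right h.2 _⟩

theorem CongruenceSimple.eq_univ_of_isBiIdeal (hR : CongruenceSimple R) (hI : IsBiIdeal I)
    (hnt : I.Nontrivial) : I = Set.univ := by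
  obtain ⟨a, ha, b, hb, hab⟩ := hnt
  refine Set.eq_univ_of_forall fun x => ?_
  rcases hR.rel_of_ne hI.reesCon hab (Or.inr ⟨ha, hb⟩) x a with rfl | h
  exacts [ha, h.1]

end BiIdeal

theorem encard_univ_mul_univ_eq_one_iff {R : Type*} [Mul R] [Nonempty R] :
    (Set.univ * Set.univ : Set R).encard = 1 ↔ ∃ w : R, ∀ a b : R, a * b = w := by
  simp only [Set.encard_eq_one, Set.eq_singleton_iff_nonempty_unique_mem, Set.mem_mul,
    Set.mem_univ, true_and, forall_exists_index, Set.univ_nonempty.mul Set.univ_nonempty]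
  exact exists_congr fun w => ⟨fun h a b => h _ a b rfl, fun h _ a b hab => hab ▸ h a b⟩

section NonemptySum

variable {S : Type*} [AddCommSemigroup S] {ι : Type*} [Fintype ι] [Nonempty ι]

theorem nonemptySum_induction₂ {f g : ι → S} {r : S → S → Prop}
    (hadd : ∀ {a b c d}, r a b → r c d → r (a + c) (b + d)) (h : ∀ i, r (f i) (g i)) :
    r (nonemptySum f) (nonemptySum g) := by
  have key (s : Finset ι) (hs : s.Nonempty) : ∃ a b : S,
      (∑ i ∈ s, (f i : WithZero S)) = a ∧ (∑ i ∈ s, (g i : WithZero S)) = b ∧ r a b := by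
    induction hs using Finset.Nonempty.cons_induction with
    | singleton i => exact ⟨f i, g i, by simp, by simp, h i⟩
    | cons i s hi _ ih =>
      obtain ⟨a, b, ha, hb, hab⟩ := ih
      exact ⟨f i + a, g i + b, by rw [Finset.sum_cons, ha, WithZero.coe_add],
        by rw [Finset.sum_cons, hb, WithZero.coe_add], hadd (h i) hab⟩
  obtain ⟨a, b, ha, hb, hab⟩ := key Finset.univ Finset.univ_nonempty
  rw [← coe_nonemptySum] at ha hb
  rwa [WithZero.coe_injective ha, WithZero.coe_injective hb]

theorem nonemptySum_eq_or_exists_add (f : ι → S) (i : ι) :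
    nonemptySum f = f i ∨ ∃ t, nonemptySum f = t + f i := by
  classical
  have hsum : ((nonemptySum f : S) : WithZero S) =
      (∑ j ∈ Finset.univ.erase i, (f j : WithZero S)) + f i := by
    rw [coe_nonemptySum, Finset.sum_erase_add _ _ (Finset.mem_univ i)]
  rcases eq_or_ne (∑ j ∈ Finset.univ.erase i, (f j : WithZero S)) 0 with h | h
  · left
    rw [h, zero_add] at hsum
    exact WithZero.coe_injective hsum
  · right
    obtain ⟨t, ht⟩ := WithZero.ne_zero_iff_exists.1 h
    rw [← ht, ← WithZero.coe_add] at hsum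
    exact ⟨t, WithZero.coe_injective hsum⟩

theorem nonemptySum_eq_of_forall_add_eq {f : ι → S} {i : ι} (h : ∀ a, a + f i = f i) :
    nonemptySum f = f i := by
  rcases nonemptySum_eq_or_exists_add f i with hf | ⟨t, ht⟩
  exacts [hf, ht.trans (h t)]

end NonemptySum

namespace MatrixSemiring

variable {n : ℕ} {S : Type*}

@[ext]
theorem ext {A B : MatrixSemiring n S} (h : ∀ i j, A i j = B i j) : A = B :=
  funext fun i => funext fun j => h i j

/-- The matrix all of whose entries are equal to `a`. -/
def const (n : ℕ) (a : S) : MatrixSemiring n S := fun _ _ => a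

theorem const_apply (a : S) (i j : Fin n) : const n a i j = a := rfl

theorem const_injective [NeZero n] : Function.Injective (const n : S → MatrixSemiring n S) :=
  fun _ _ h => congrFun (congrFun h 0) 0

theorem exists_ne_const_and_apply_zero_eq [NeZero n] [Nontrivial S] (hn : 2 ≤ n) (a : S) :
    ∃ A : MatrixSemiring n S, A ≠ const n a ∧ A 0 0 = a := by
  have := Fin.nontrivial_iff_two_le.2 hn
  obtain ⟨i, hi⟩ := exists_ne (0 : Fin n)
  obtain ⟨b, hb⟩ := exists_ne a
  refine ⟨fun k _ => if k = 0 then a else b, fun h => hb ?_, if_pos rfl⟩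
  have h_entry := congrFun (congrFun h i) 0
  simpa only [hi, if_false, const_apply] using h_entry

theorem add_apply [Add S] (A B : MatrixSemiring n S) (i j : Fin n) :
    (A + B) i j = A i j + B i j := rfl

instance [AddCommSemigroup S] : AddCommSemigroup (MatrixSemiring n S) where
  add_assoc _ _ _ := ext fun _ _ => add_assoc _ _ _
  add_comm _ _ := ext fun _ _ => add_comm _ _

variable [NeZero n] [AddCommSemigroup S] [Mul S]

theorem mul_apply (A B : MatrixSemiring n S) (i j : Fin n) :
    (A * B) i j = nonemptySum fun k => A i k * B k j := rfl

/-- The congruence of the matrix semiring that holds when `c` relates all pairs of entries. -/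
def entrywiseCon (n : ℕ) [NeZero n] (c : RingCon S) : RingCon (MatrixSemiring n S) where
  r A B := ∀ i j, c (A i j) (B i j)
  iseqv :=
    { refl := fun _ _ _ => c.refl _
      symm := fun h i j => c.symm (h i j)
      trans := fun h h' i j => c.trans (h i j) (h' i j) }
  add' h h' i j := c.add (h i j) (h' i j)
  mul' h h' i j := nonemptySum_induction₂ c.add fun k => c.mul (h i k) (h' k j)

/-- Equality of the entries at a given position. It is a congruence of the matrix semiring when
the multiplication of `S` is constant, because then so is that of the matrices. -/
def entryCon (i j : Fin n) {w : S} (hw : ∀ a b : S, a * b = w) : RingCon (MatrixSemiring n S) where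
  r A B := A i j = B i j
  iseqv := ⟨fun _ => rfl, Eq.symm, Eq.trans⟩
  add' h h' := congrArg₂ (· + ·) h h'
  mul' _ _ := by simp only [mul_apply, hw]

theorem isBiIdeal_exists_entry_eq {w : S} (hw : IsBiAbsorbing w) :
    IsBiIdeal {A : MatrixSemiring n S | ∃ i j, A i j = w} where
  add_mem_right := by
    rintro A ⟨i, j, hij⟩ B
    exact ⟨i, j, by rw [add_apply, hij, add_comm, hw.2.2]⟩
  mul_mem_right := by
    rintro A ⟨i, j, hij⟩ B
    have hentry : A i j * B j 0 = w := by rw [hij, hw.2.1]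
    refine ⟨i, 0, (nonemptySum_eq_of_forall_add_eq (i := j) ?_).trans hentry⟩
    rw [hentry]
    exact hw.2.2
  mul_mem_left := by
    rintro A ⟨i, j, hij⟩ B
    have hentry : B 0 i * A i j = w := by rw [hij, hw.1]
    refine ⟨0, j, (nonemptySum_eq_of_forall_add_eq (i := i) ?_).trans hentry⟩
    rw [hentry]
    exact hw.2.2

end MatrixSemiring

section OfMatrixSemiring

open MatrixSemiring

variable {S : Type*} [AddCommSemigroup S] [Mul S] {n : ℕ} [NeZero n]

theorem CongruenceSimple.of_matrixSemiring (h : CongruenceSimple (MatrixSemiring n S)) :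
    CongruenceSimple S := by
  refine congruenceSimple_iff_forall_rel.2 ⟨?_, fun c a b hab hc x y => ?_⟩
  · obtain ⟨A, B, hAB⟩ := h.nontrivial
    by_contra hS
    rw [not_nontrivial_iff_subsingleton] at hS
    exact hAB (MatrixSemiring.ext fun _ _ => Subsingleton.elim _ _)
  · exact h.rel_of_ne (entrywiseCon n c) (const_injective.ne hab) (fun _ _ => hc)
      (const n x) (const n y) 0 0

theorem encard_univ_mul_univ_ne_one_of_matrixSemiring (h : CongruenceSimple (MatrixSemiring n S))
    (hn : 2 ≤ n) : (Set.univ * Set.univ : Set S).encard ≠ 1 := by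
  have := h.of_matrixSemiring.nontrivial
  intro hSS
  obtain ⟨w, hw⟩ := encard_univ_mul_univ_eq_one_iff.1 hSS
  obtain ⟨a, b, hab⟩ := exists_pair_ne S
  obtain ⟨A, hA, hA₀⟩ := exists_ne_const_and_apply_zero_eq hn a
  exact hab (h.rel_of_ne (entryCon 0 0 hw) hA hA₀ (const n a) (const n b))

theorem not_exists_isBiAbsorbing_of_matrixSemiring (h : CongruenceSimple (MatrixSemiring n S))
    (hn : 2 ≤ n) : ¬ ∃ w : S, IsBiAbsorbing w := by
  have := h.of_matrixSemiring.nontrivial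
  rintro ⟨w, hw⟩
  obtain ⟨A, hA, hA₀⟩ := exists_ne_const_and_apply_zero_eq hn w
  have huniv := h.eq_univ_of_isBiIdeal (isBiIdeal_exists_entry_eq hw)
    ⟨A, ⟨0, 0, hA₀⟩, const n w, ⟨0, 0, rfl⟩, hA⟩
  obtain ⟨s, hs⟩ := exists_ne w
  obtain ⟨i, _, hij⟩ := huniv.symm ▸ Set.mem_univ (const n s)
  exact hs hij

end OfMatrixSemiring

section NaturalOrder

/-- The natural order `a ≤ b ↔ a + b = b` of an additively idempotent semigroup, in which the sum
of two elements is their join. -/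
abbrev naturalOrder {S : Type*} [AddCommSemigroup S] (hidem : ∀ a : S, a + a = a) :
    SemilatticeSup S :=
  @SemilatticeSup.mk' S ⟨(· + ·)⟩ add_comm add_assoc hidem

/-- The order of `S` is its natural order: addition is the join. -/
class AddIsSup (S : Type*) [Add S] [SemilatticeSup S] : Prop where
  add_eq_sup : ∀ a b : S, a + b = a ⊔ b

section NonemptySum

variable {S : Type*} [AddCommSemigroup S] [SemilatticeSup S] [AddIsSup S]
  {ι : Type*} [Fintype ι] [Nonempty ι] {f : ι → S}

theorem nonemptySum_le {a : S} (h : ∀ i, f i ≤ a) : nonemptySum f ≤ a :=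
  nonemptySum_induction₂ (g := f) (r := fun x _ => x ≤ a)
    (fun hx hy => by rw [AddIsSup.add_eq_sup]; exact sup_le hx hy) h

theorem le_nonemptySum (f : ι → S) (i : ι) : f i ≤ nonemptySum f := by
  rcases nonemptySum_eq_or_exists_add f i with h | ⟨t, h⟩
  · exact h.ge
  · rw [h, AddIsSup.add_eq_sup]
    exact le_sup_right

theorem nonemptySum_eq_of_forall_le {i : ι} (h : ∀ j, f j ≤ f i) : nonemptySum f = f i :=
  (nonemptySum_le h).antisymm (le_nonemptySum f i)

end NonemptySum

variable {S : Type*} [Add S] [Mul S] [SemilatticeSup S] [AddIsSup S]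

theorem rel_of_rel_of_le_of_le (r : RingCon S) {x y z : S} (hxz : r x z) (hxy : x ≤ y)
    (hyz : y ≤ z) : r y z := by
  have h := r.add (r.refl y) hxz
  rwa [AddIsSup.add_eq_sup, AddIsSup.add_eq_sup, sup_eq_left.2 hxy, sup_eq_right.2 hyz] at h

theorem mul_sup_of_addIsSup [LeftDistribClass S] (a b c : S) : a * (b ⊔ c) = a * b ⊔ a * c := by
  simp only [← AddIsSup.add_eq_sup, mul_add]

instance [LeftDistribClass S] : MulLeftMono S where
  elim a b c (h : b ≤ c) := by
    change a * b ≤ a * c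
    rw [← sup_eq_right, ← mul_sup_of_addIsSup, sup_eq_right.2 h]

instance [LeftDistribClass S] [IsLeftCancelMul S] : MulLeftReflectLE S where
  le_of_mul_le_mul_left' {a b c} h := by
    rw [← sup_eq_right, ← mul_sup_of_addIsSup] at h
    exact sup_eq_right.1 (mul_left_cancel h)

end NaturalOrder

namespace MatrixSemiring

variable {n : ℕ} {S : Type*}

theorem exists_forall_le_apply [Preorder S] [Nonempty S] [IsCodirectedOrder S]
    (A : MatrixSemiring n S) : ∃ t, ∀ i j, t ≤ A i j :=
  (Finite.bddBelow_range fun p : Fin n × Fin n => A p.1 p.2).imp fun _ ht i j =>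
    ht ⟨(i, j), rfl⟩

theorem exists_forall_apply_le [Preorder S] [Nonempty S] [IsDirectedOrder S]
    (A : MatrixSemiring n S) : ∃ t, ∀ i j, A i j ≤ t :=
  (Finite.bddAbove_range fun p : Fin n × Fin n => A p.1 p.2).imp fun _ ht i j =>
    ht ⟨(i, j), rfl⟩

/-- The matrix with `c` in column `i` and `N` elsewhere. Multiplying by it from the left copies
`c` times row `i` into every row, provided that `N` is small enough. -/
def rowSelector (c N : S) (i : Fin n) : MatrixSemiring n S := fun _ k => if k = i then c else N

/-- The matrix with `c` in row `j` and `N` elsewhere. Multiplying by it from the right copies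
`c` times column `j` into every column, provided that `N` is small enough. -/
def colSelector (c N : S) (j : Fin n) : MatrixSemiring n S := fun k _ => if k = j then c else N

section Order

variable [NeZero n] [AddCommSemigroup S] [SemilatticeSup S] [AddIsSup S]

theorem const_mul_const [Mul S] (a b : S) : const n a * const n b = const n (a * b) :=
  MatrixSemiring.ext fun _ _ =>
    nonemptySum_eq_of_forall_le (f := fun _ => a * b) (i := (0 : Fin n)) fun _ => le_rfl

/-- The congruence that a congruence of the matrix semiring induces on the constant matrices. -/
def constCon [Mul S] (r : RingCon (MatrixSemiring n S)) : RingCon S where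
  r a b := r (const n a) (const n b)
  iseqv := ⟨fun _ => r.refl _, r.symm, r.trans⟩
  add' h h' := r.add h h'
  mul' h h' := by
    rw [← const_mul_const, ← const_mul_const]
    exact r.mul h h'

theorem rowSelector_mul_apply [Mul S] {c N : S} {A : MatrixSemiring n S} {i l : Fin n}
    (h : ∀ m, N * A m l ≤ c * A i l) (k : Fin n) : (rowSelector c N i * A) k l = c * A i l := by
  have hentry : rowSelector c N i k i * A i l = c * A i l := by rw [rowSelector, if_pos rfl]
  refine (nonemptySum_eq_of_forall_le (i := i) fun m => ?_).trans hentry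
  rw [hentry, rowSelector]
  split_ifs with hm
  exacts [hm ▸ le_rfl, h m]

variable [CommSemigroup S]

theorem mul_colSelector_apply {c N : S} {A : MatrixSemiring n S} {j k : Fin n}
    (h : ∀ m, N * A k m ≤ c * A k j) (l : Fin n) : (A * colSelector c N j) k l = c * A k j := by
  have hentry : A k j * colSelector c N j j l = c * A k j := by
    rw [colSelector, if_pos rfl, mul_comm]
  refine (nonemptySum_eq_of_forall_le (i := j) fun m => ?_).trans hentry
  rw [hentry, colSelector, mul_comm]
  split_ifs with hm
  exacts [hm ▸ le_rfl, h m]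

variable [LeftDistribClass S]

theorem rowSelector_mul_mul_colSelector {c N : S} {A : MatrixSemiring n S}
    (h : ∀ k l k' l', N * A k l ≤ c * A k' l') (i j : Fin n) :
    rowSelector c N i * A * colSelector c N j = const n (c * (c * A i j)) := by
  have hrow (k l : Fin n) : (rowSelector c N i * A) k l = c * A i l :=
    rowSelector_mul_apply (fun m => h m l i l) k
  ext k l
  rw [mul_colSelector_apply, hrow, const_apply]
  intro m
  rw [hrow, hrow, mul_left_comm]
  exact mul_le_mul_right (h i m i j) c

end Order

theorem exists_forall_mul_apply_le [Nonempty S] [AddCommSemigroup S] [SemilatticeSup S]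
    [AddIsSup S] [CommSemigroup S] [LeftDistribClass S] [IsCodirectedOrder S] {c : S}
    (hdom : ∀ M m : S, ∃ N, N * M ≤ c * m) (A B : MatrixSemiring n S) :
    ∃ N, (∀ i j k l, N * A i j ≤ c * A k l) ∧ ∀ i j k l, N * B i j ≤ c * B k l := by
  obtain ⟨t, ht⟩ := exists_forall_apply_le (A + B)
  obtain ⟨a, ha⟩ := exists_forall_le_apply A
  obtain ⟨b, hb⟩ := exists_forall_le_apply B
  obtain ⟨s, hsa, hsb⟩ := exists_le_le a b
  obtain ⟨N, hN⟩ := hdom t s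
  have hle {x y : S} (hx : x ≤ t) (hy : s ≤ y) : N * x ≤ c * y :=
    (mul_le_mul_right hx N).trans (hN.trans (mul_le_mul_right hy c))
  simp only [add_apply, AddIsSup.add_eq_sup, sup_le_iff] at ht
  exact ⟨N, fun i j k l => hle (ht i j).1 (hsa.trans (ha k l)),
    fun i j k l => hle (ht i j).2 (hsb.trans (hb k l))⟩

theorem rel_of_forall_rel_const [NeZero n] [AddCommSemigroup S] [SemilatticeSup S] [AddIsSup S]
    [Mul S] [Nonempty S] [IsCodirectedOrder S] {r : RingCon (MatrixSemiring n S)}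
    (h : ∀ a b, r (const n a) (const n b)) (A B : MatrixSemiring n S) : r A B := by
  have hrel_const (A : MatrixSemiring n S) : ∃ t, r A (const n t) := by
    obtain ⟨s, hs⟩ := exists_forall_le_apply A
    obtain ⟨t, ht⟩ := exists_forall_apply_le A
    have hAs : A + const n s = A := by
      ext i j
      rw [add_apply, AddIsSup.add_eq_sup]
      exact sup_eq_left.2 (hs i j)
    have hAt : A + const n t = const n t := by
      ext i j
      rw [add_apply, AddIsSup.add_eq_sup]
      exact sup_eq_right.2 (ht i j)
    have hrel := r.add (r.refl A) (h s t)
    rw [hAs, hAt] at hrel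
    exact ⟨t, hrel⟩
  obtain ⟨a, ha⟩ := hrel_const A
  obtain ⟨b, hb⟩ := hrel_const B
  exact r.trans ha (r.trans (h a b) (r.symm hb))

end MatrixSemiring

open MatrixSemiring in
theorem CongruenceSimple.matrixSemiring {S : Type*} [AddCommSemigroup S] [SemilatticeSup S]
    [AddIsSup S] [CommSemigroup S] [LeftDistribClass S] [IsCodirectedOrder S]
    (hS : CongruenceSimple S) {c : S} (hc : Function.Injective (c * ·))
    (hdom : ∀ M m : S, ∃ N, N * M ≤ c * m) (n : ℕ) [NeZero n] :
    CongruenceSimple (MatrixSemiring n S) := by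
  have := hS.nontrivial
  refine congruenceSimple_iff_forall_rel.2
    ⟨const_injective.nontrivial, fun r {A B} hAB hr => rel_of_forall_rel_const ?_⟩
  obtain ⟨i, j, hij⟩ : ∃ i j, A i j ≠ B i j := by
    by_contra! h
    exact hAB (MatrixSemiring.ext h)
  obtain ⟨N, hA, hB⟩ := exists_forall_mul_apply_le hdom A B
  have hrel : constCon r (c * (c * A i j)) (c * (c * B i j)) := by
    have h := r.mul (r.mul (r.refl (rowSelector c N i)) hr) (r.refl (colSelector c N j))
    rwa [rowSelector_mul_mul_colSelector hA, rowSelector_mul_mul_colSelector hB] at h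
  exact hS.rel_of_ne (constCon r) ((hc.comp hc).ne hij) hrel

section JoinCon

variable {S : Type*} [Add S] [SemilatticeSup S] [AddIsSup S] [CommSemigroup S] [LeftDistribClass S]

/-- Equality after joining with `w`. It is a congruence when the elements below `w` form an
ideal. -/
def joinCon {w : S} (hw : ∀ z, w * z ≤ w) : RingCon S where
  r x y := x ⊔ w = y ⊔ w
  iseqv := ⟨fun _ => rfl, Eq.symm, Eq.trans⟩
  add' {x y z t} h h' := by
    rw [AddIsSup.add_eq_sup, AddIsSup.add_eq_sup, sup_sup_distrib_right, h, h',
      ← sup_sup_distrib_right]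
  mul' {x y z t} h h' := by
    have hmul (u v : S) : u * v ⊔ w = u * (v ⊔ w) ⊔ w := by
      have huw : u * w ≤ w := mul_comm w u ▸ hw u
      rw [mul_sup_of_addIsSup, sup_assoc, sup_eq_right.2 huw]
    calc x * z ⊔ w = x * (t ⊔ w) ⊔ w := by rw [hmul, h']
      _ = t * (y ⊔ w) ⊔ w := by rw [← hmul, mul_comm, hmul, h]
      _ = y * t ⊔ w := by rw [← hmul, mul_comm]

end JoinCon

/-- An embedding of a semiring into the max-plus semiring of the real numbers, given by the
underlying real-valued function. -/
structure IsMaxPlusEmbedding {S : Type*} [Add S] [Mul S] (φ : S → ℝ) : Prop where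
  injective : Function.Injective φ
  map_add : ∀ x y, φ (x + y) = max (φ x) (φ y)
  map_mul : ∀ x y, φ (x * y) = φ x + φ y

namespace IsMaxPlusEmbedding

section Semiring

variable {S : Type*} [Add S] [Mul S] {φ : S → ℝ}

theorem map_mul_iterate (hφ : IsMaxPlusEmbedding φ) (a b : S) (n : ℕ) :
    φ ((a * ·)^[n] b) = n * φ a + φ b := by
  induction n with
  | zero => simp
  | succ n ih =>
    rw [Function.iterate_succ_apply', hφ.map_mul, ih]
    push_cast
    ring

theorem exists_mem_Ico (hφ : IsMaxPlusEmbedding φ) {p q : S} (hp : 0 < φ p) (hq : φ q < 0)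
    (u : ℝ) : ∃ x, φ x ∈ Set.Ico u (u + φ p) := by
  obtain ⟨s, hs⟩ : ∃ s, φ s < u := by
    obtain ⟨k, hk⟩ := Archimedean.arch (-u) (neg_pos.2 hq)
    refine ⟨(q * ·)^[k] q, ?_⟩
    rw [nsmul_eq_mul] at hk
    rw [hφ.map_mul_iterate]
    linarith
  obtain ⟨m, hm, -⟩ := existsUnique_add_zsmul_mem_Ico hp (φ s) u
  rw [zsmul_eq_mul] at hm
  lift m to ℕ
  · by_contra! hneg
    have : (m : ℝ) < 0 := Int.cast_lt_zero.2 hneg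
    nlinarith [hm.1]
  refine ⟨(p * ·)^[m] s, ?_⟩
  rw [hφ.map_mul_iterate, add_comm (_ * _)]
  exact_mod_cast hm

theorem exists_ne_zero [Nontrivial S] (hφ : IsMaxPlusEmbedding φ) : ∃ t, φ t ≠ 0 := by
  by_contra! h
  obtain ⟨a, b, hab⟩ := exists_pair_ne S
  exact hab (hφ.injective ((h a).trans (h b).symm))

end Semiring

section Order

variable {S : Type*} [Add S] [Mul S] [SemilatticeSup S] [AddIsSup S] {φ : S → ℝ}

theorem le_iff_le (hφ : IsMaxPlusEmbedding φ) {x y : S} : φ x ≤ φ y ↔ x ≤ y := by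
  rw [← sup_eq_right (a := x), ← AddIsSup.add_eq_sup, ← hφ.injective.eq_iff, hφ.map_add,
    max_eq_right_iff]

theorem lt_iff_lt (hφ : IsMaxPlusEmbedding φ) {x y : S} : φ x < φ y ↔ x < y := by
  rw [lt_iff_le_not_ge, lt_iff_le_not_ge, hφ.le_iff_le, hφ.le_iff_le]

theorem le_total (hφ : IsMaxPlusEmbedding φ) (x y : S) : x ≤ y ∨ y ≤ x := by
  simpa only [hφ.le_iff_le] using _root_.le_total (φ x) (φ y)

/-- The powers of a pair of related elements, multiplied by a common factor, span intervals
that exhaust the line. -/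
theorem congruenceSimple (hφ : IsMaxPlusEmbedding φ) {p q : S} (hp : 0 < φ p) (hq : φ q < 0) :
    CongruenceSimple S := by
  refine congruenceSimple_iff_forall_rel.2
    ⟨⟨p, q, fun h => (hq.trans hp).ne (h ▸ rfl)⟩, fun r {a b} hab hr x y => ?_⟩
  wlog hle : a ≤ b generalizing a b
  · exact this hab.symm (r.symm hr) ((hφ.le_total a b).resolve_left hle)
  wlog hxy : x ≤ y generalizing x y
  · exact r.symm (this y x ((hφ.le_total x y).resolve_left hxy))
  have hφab : φ a < φ b := hφ.lt_iff_lt.2 (hle.lt_of_ne hab)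
  obtain ⟨k, hk⟩ := Archimedean.arch (φ y - φ x + φ p) (sub_pos.2 hφab)
  obtain ⟨z, hz, hz'⟩ := hφ.exists_mem_Ico hp hq (φ y - k * φ b)
  have hrel : r ((a * ·)^[k] z) ((b * ·)^[k] z) := by
    clear hk hz hz'
    induction k with
    | zero => exact r.refl z
    | succ k ih =>
      rw [Function.iterate_succ_apply', Function.iterate_succ_apply']
      exact r.mul hr ih
  have hax : (a * ·)^[k] z ≤ x := by
    rw [← hφ.le_iff_le, hφ.map_mul_iterate]
    rw [nsmul_eq_mul, mul_sub] at hk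
    linarith
  have hyb : y ≤ (b * ·)^[k] z := by
    rw [← hφ.le_iff_le, hφ.map_mul_iterate]
    linarith
  exact r.trans (rel_of_rel_of_le_of_le r hrel hax (hxy.trans hyb))
    (r.symm (rel_of_rel_of_le_of_le r hrel (hax.trans hxy) hyb))

end Order

theorem congruenceSimple_matrixSemiring {S : Type*} [AddCommSemigroup S] [SemilatticeSup S]
    [AddIsSup S] [CommSemigroup S] [LeftDistribClass S] {φ : S → ℝ} (hφ : IsMaxPlusEmbedding φ)
    {p q : S} (hp : 0 < φ p) (hq : φ q < 0) (n : ℕ) [NeZero n] :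
    CongruenceSimple (MatrixSemiring n S) := by
  have : IsCodirectedOrder S := ⟨fun x y => (hφ.le_total x y).elim
    (fun h => ⟨x, le_rfl, h⟩) fun h => ⟨y, h, le_rfl⟩⟩
  refine (hφ.congruenceSimple hp hq).matrixSemiring (c := p)
    (fun x y h => hφ.injective ?_) (fun M m => ?_) n
  · simpa only [hφ.map_mul, add_right_inj] using congrArg φ h
  · obtain ⟨N, -, hN⟩ := hφ.exists_mem_Ico hp hq (φ m - φ M)
    refine ⟨N, ?_⟩
    rw [← hφ.le_iff_le, hφ.map_mul, hφ.map_mul]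
    linarith

theorem exists_pos {S : Type*} [Add S] [SemilatticeSup S] [AddIsSup S] [CommSemigroup S]
    [LeftDistribClass S] {φ : S → ℝ} (hφ : IsMaxPlusEmbedding φ) (hS : CongruenceSimple S) :
    ∃ p, 0 < φ p := by
  have := hS.nontrivial
  by_contra! hneg
  obtain ⟨t, ht⟩ := hφ.exists_ne_zero
  have ht : φ t < 0 := (hneg t).lt_of_ne ht
  have hw (z : S) : t * t * z ≤ t * t := by
    rw [← hφ.le_iff_le, hφ.map_mul]
    linarith [hneg z]
  have hlt : t * t * t < t * t := by
    rw [← hφ.lt_iff_lt, hφ.map_mul]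
    linarith
  have hrel : joinCon hw (t * t * t) (t * t) := by
    change t * t * t ⊔ t * t = t * t ⊔ t * t
    rw [sup_eq_right.2 hlt.le, sup_idem]
  have hle : t ≤ t * t := by
    have h : t ⊔ t * t = t * t ⊔ t * t := hS.rel_of_ne _ hlt.ne hrel t (t * t)
    rwa [sup_idem, sup_eq_right] at h
  rw [← hφ.le_iff_le, hφ.map_mul] at hle
  linarith

theorem exists_neg {S : Type*} [AddCommMagma S] [Mul S] {φ : S → ℝ} (hφ : IsMaxPlusEmbedding φ)
    (hS : CongruenceSimple S) : ∃ q, φ q < 0 := by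
  have := hS.nontrivial
  by_contra! hpos
  obtain ⟨t, ht⟩ := hφ.exists_ne_zero
  have ht : 0 < φ t := (hpos t).lt_of_ne' ht
  have hI : IsBiIdeal {x | φ (t * t) ≤ φ x} :=
    { add_mem_right := fun {x} (hx : φ (t * t) ≤ φ x) z => by
        change _ ≤ φ (x + z)
        exact hx.trans (hφ.map_add x z ▸ le_max_left _ _)
      mul_mem_right := fun {x} (hx : φ (t * t) ≤ φ x) z => by
        change _ ≤ φ (x * z)
        linarith [hφ.map_mul x z, hpos z]
      mul_mem_left := fun {x} (hx : φ (t * t) ≤ φ x) z => by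
        change _ ≤ φ (z * x)
        linarith [hφ.map_mul z x, hpos z] }
  have huniv := hS.eq_univ_of_isBiIdeal hI ⟨t * t, le_refl (φ (t * t)), t * t * t, ?_, ?_⟩
  · have htI : φ (t * t) ≤ φ t := huniv.ge (Set.mem_univ t)
    linarith [hφ.map_mul t t]
  · change _ ≤ φ (t * t * t)
    linarith [hφ.map_mul (t * t) t]
  · intro h
    linarith [hφ.map_mul (t * t) t, congrArg φ h]

end IsMaxPlusEmbedding

section Range

variable {S : Type*} [Add S] [Mul S]

theorem MaxPlus.toReal_injective : Function.Injective MaxPlus.toReal :=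
  OrderDual.ofDual.injective.comp Tropical.untrop_injective

/-- The image of an embedding into the max-plus semiring. -/
def IsMaxPlusEmbedding.range [Nonempty S] {φ : S → ℝ} (hφ : IsMaxPlusEmbedding φ) :
    PlainSubsemiring MaxPlus where
  carrier := {x | ∃ s, φ s = x.toReal}
  add_mem' := by
    rintro _ _ ⟨s, hs⟩ ⟨t, ht⟩
    exact ⟨s + t, by rw [hφ.map_add, hs, ht, MaxPlus.toReal_add]⟩
  mul_mem' := by
    rintro _ _ ⟨s, hs⟩ ⟨t, ht⟩
    exact ⟨s * t, by rw [hφ.map_mul, hs, ht, MaxPlus.toReal_mul]⟩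
  nonempty' := ⟨Tropical.trop (OrderDual.toDual (φ (Classical.arbitrary S))), _, rfl⟩

/-- The isomorphism of a semiring with its image in the max-plus semiring. -/
noncomputable def IsMaxPlusEmbedding.ringEquivRange [Nonempty S] {φ : S → ℝ}
    (hφ : IsMaxPlusEmbedding φ) : S ≃+* hφ.range where
  toEquiv := Equiv.ofBijective
    (fun s => ⟨Tropical.trop (OrderDual.toDual (φ s)), s, rfl⟩)
    ⟨fun _ _ h => hφ.injective (congrArg (fun x => x.1.toReal) h),
      fun ⟨_, s, hs⟩ => ⟨s, Subtype.ext (MaxPlus.toReal_injective hs)⟩⟩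
  map_mul' s t := Subtype.ext (MaxPlus.toReal_injective (hφ.map_mul s t))
  map_add' s t := Subtype.ext (MaxPlus.toReal_injective (hφ.map_add s t))

theorem IsMaxPlusEmbedding.toReal_ringEquivRange [Nonempty S] {φ : S → ℝ}
    (hφ : IsMaxPlusEmbedding φ) (s : S) : (hφ.ringEquivRange s : MaxPlus).toReal = φ s := rfl

theorem isMaxPlusEmbedding_toReal_comp {A : PlainSubsemiring MaxPlus} (e : S ≃+* A) :
    IsMaxPlusEmbedding fun s => (e s : MaxPlus).toReal where
  injective := MaxPlus.toReal_injective.comp (Subtype.val_injective.comp e.injective)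
  map_add x y := by rw [map_add]; rfl
  map_mul x y := by rw [map_mul]; rfl

end Range

section TwoLattice

instance : MulZeroOneClass TwoLattice where
  zero := false
  one := true
  zero_mul a := by cases a <;> rfl
  mul_zero a := by cases a <;> rfl
  one_mul a := by cases a <;> rfl
  mul_one a := by cases a <;> rfl

instance : AddZeroClass TwoLattice where
  zero_add a := by cases a <;> rfl
  add_zero a := by cases a <;> rfl

theorem congruenceSimple_matrixSemiring_of_twoLattice {S : Type*} [AddCommSemigroup S]
    [SemilatticeSup S] [AddIsSup S] [CommSemigroup S] [LeftDistribClass S] (e : S ≃+* TwoLattice)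
    (n : ℕ) [NeZero n] : CongruenceSimple (MatrixSemiring n S) := by
  obtain ⟨o, ho⟩ := e.surjective 0
  obtain ⟨i, hi⟩ := e.surjective 1
  have ho_mul (x : S) : o * x = o := e.injective (by rw [map_mul, ho, zero_mul])
  have hi_mul (x : S) : i * x = x := e.injective (by rw [map_mul, hi, one_mul])
  have ho_le (x : S) : o ≤ x := by
    rw [← sup_eq_right, ← AddIsSup.add_eq_sup]
    exact e.injective (by rw [map_add, ho, zero_add])
  have : IsCodirectedOrder S := ⟨fun x y => ⟨o, ho_le x, ho_le y⟩⟩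
  have hS : CongruenceSimple S :=
    congruenceSimple_of_card_eq_two
      ((Nat.card_congr e.toEquiv).trans (Nat.card_eq_fintype_card (α := Bool)))
  refine hS.matrixSemiring (c := i) (fun x y h => ?_) (fun M m => ⟨o, ?_⟩) n
  · simpa only [hi_mul] using h
  · rw [ho_mul]
    exact ho_le _

section ZeroCon

variable {S : Type*} [Add S] [Mul S] {o : S}

/-- The congruence with the two classes `{o}` and `{x | x ≠ o}`, for a zero `o` of a semiring
without zero sums and zero divisors. -/
def zeroCon (hadd : ∀ x y : S, x + y = o ↔ x = o ∧ y = o)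
    (hmul : ∀ x y : S, x * y = o ↔ x = o ∨ y = o) : RingCon S where
  r x y := x = o ↔ y = o
  iseqv := ⟨fun _ => Iff.rfl, Iff.symm, Iff.trans⟩
  add' h h' := by rw [hadd, hadd, h, h']
  mul' h h' := by rw [hmul, hmul, h, h']

theorem CongruenceSimple.nonempty_ringEquiv_twoLattice (hS : CongruenceSimple S)
    (hadd : ∀ x y : S, x + y = o ↔ x = o ∧ y = o)
    (hmul : ∀ x y : S, x * y = o ↔ x = o ∨ y = o) : Nonempty (S ≃+* TwoLattice) := by
  classical
  have := hS.nontrivial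
  let f (x : S) : TwoLattice := decide (x ≠ o)
  have hf : Function.Bijective f := by
    refine ⟨fun x y h => ?_, fun b => ?_⟩
    · by_contra hxy
      have hrel : zeroCon hadd hmul x y := not_iff_not.1 (decide_eq_decide.1 h)
      have hall (z : S) : z = o := (hS.rel_of_ne _ hxy hrel z o).2 rfl
      exact hxy ((hall x).trans (hall y).symm)
    · cases b
      · exact ⟨o, decide_eq_false fun h => h rfl⟩
      · obtain ⟨x, hx⟩ := exists_ne o
        exact ⟨x, decide_eq_true hx⟩
  refine ⟨{ Equiv.ofBijective f hf with map_mul' := fun x y => ?_, map_add' := fun x y => ?_ }⟩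
  · change decide (x * y ≠ o) = (decide (x ≠ o) && decide (y ≠ o))
    rw [← Bool.decide_and, decide_eq_decide, ne_eq, hmul, not_or]
  · change decide (x + y ≠ o) = (decide (x ≠ o) || decide (y ≠ o))
    rw [← Bool.decide_or, decide_eq_decide, ne_eq, hadd, not_and_or]

end ZeroCon

end TwoLattice

section Dichotomy

/-- The kernel of the regular representation: `x` and `y` are related when all elements of `S`
have the same product with them. -/
def regularCon (S : Type*) [Add S] [Semigroup S] [LeftDistribClass S] : RingCon S where
  r x y := ∀ z, z * x = z * y
  iseqv := ⟨fun _ _ => rfl, fun h z => (h z).symm, fun h h' z => (h z).trans (h' z)⟩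
  add' h h' z := by rw [mul_add, mul_add, h, h']
  mul' h h' w := by rw [← mul_assoc, ← mul_assoc, h, h']

/-- The kernel of the multiplication by `a`. -/
def mulLeftCon {S : Type*} [Add S] [CommSemigroup S] [LeftDistribClass S] (a : S) : RingCon S where
  r x y := a * x = a * y
  iseqv := ⟨fun _ => rfl, Eq.symm, Eq.trans⟩
  add' h h' := by rw [mul_add, mul_add, h, h']
  mul' {x y z t} h h' := by
    rw [← mul_assoc, h, mul_assoc, mul_left_comm, h', mul_left_comm]

section Add

variable {S : Type*} [Add S] [CommSemigroup S] [LeftDistribClass S]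

theorem CongruenceSimple.eq_of_forall_mul_eq (hS : CongruenceSimple S)
    (hSS : (Set.univ * Set.univ : Set S).encard ≠ 1) {x y : S} (h : ∀ z, z * x = z * y) :
    x = y := by
  have := hS.nontrivial
  by_contra hxy
  have hconst (a b z : S) : z * a = z * b := hS.rel_of_ne (regularCon S) hxy h a b z
  refine hSS (encard_univ_mul_univ_eq_one_iff.2 ⟨x * x, fun a b => ?_⟩)
  rw [hconst b x, mul_comm, hconst a x]

theorem CongruenceSimple.exists_absorbing (hS : CongruenceSimple S) (h : ¬ IsCancelMul S) :
    ∃ o : S, ∀ x, o * x = o := by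
  obtain ⟨a, x, y, ha, hxy⟩ : ∃ a x y : S, a * x = a * y ∧ x ≠ y := by
    by_contra! hcancel
    have : IsLeftCancelMul S := ⟨fun a _ _ h => hcancel a _ _ h⟩
    exact h (CommMagma.IsLeftCancelMul.toIsCancelMul S)
  refine ⟨a * a, fun z => ?_⟩
  rw [mul_assoc]
  exact hS.rel_of_ne (mulLeftCon a) hxy ha (a * z) a

theorem CongruenceSimple.mul_eq_absorbing_iff (hS : CongruenceSimple S)
    (hSS : (Set.univ * Set.univ : Set S).encard ≠ 1) {o : S} (ho : ∀ x, o * x = o) (x y : S) :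
    x * y = o ↔ x = o ∨ y = o := by
  have ho' (z : S) : z * o = o := (mul_comm z o).trans (ho z)
  refine ⟨fun h => ?_, ?_⟩
  · by_contra! hne
    refine hne.1 (hS.eq_of_forall_mul_eq hSS fun z => ?_)
    have hxz : x * z = x * o :=
      hS.rel_of_ne (mulLeftCon x) hne.2 (h.trans (ho' x).symm) z o
    rw [mul_comm, hxz, ho', ho']
  · rintro (rfl | rfl)
    exacts [ho y, ho' x]

end Add

variable {S : Type*} [Add S] [SemilatticeSup S] [AddIsSup S] [CommSemigroup S] [LeftDistribClass S]

theorem CongruenceSimple.absorbing_le (hS : CongruenceSimple S)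
    (hbi : ¬ ∃ w : S, IsBiAbsorbing w) {o : S} (ho : ∀ x, o * x = o) (x : S) : o ≤ x := by
  by_contra hox
  have hrel : joinCon (fun z => (ho z).le) x (x ⊔ o) := (sup_right_idem x o).symm
  refine hbi ⟨o, fun a => (mul_comm a o).trans (ho a), ho, fun a => ?_⟩
  have h : a ⊔ o = o ⊔ o := hS.rel_of_ne _ (fun h => hox (sup_eq_left.1 h.symm)) hrel a o
  rw [AddIsSup.add_eq_sup, h, sup_idem]

theorem CongruenceSimple.isCancelMul_or_nonempty_ringEquiv_twoLattice
    (hS : CongruenceSimple S) (hSS : (Set.univ * Set.univ : Set S).encard ≠ 1)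
    (hbi : ¬ ∃ w : S, IsBiAbsorbing w) : IsCancelMul S ∨ Nonempty (S ≃+* TwoLattice) := by
  refine or_iff_not_imp_left.2 fun hcancel => ?_
  obtain ⟨o, ho⟩ := hS.exists_absorbing hcancel
  refine hS.nonempty_ringEquiv_twoLattice (fun x y => ?_) (hS.mul_eq_absorbing_iff hSS ho)
  have heq_iff (z : S) : z = o ↔ z ≤ o := ⟨le_of_eq, fun h => h.antisymm (hS.absorbing_le hbi ho z)⟩
  rw [AddIsSup.add_eq_sup, heq_iff, heq_iff, heq_iff, sup_le_iff]

end Dichotomy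

/-- The group of fractions of a commutative semigroup, which need not have a unity. -/
def GroupOfFractions (S : Type*) [CommSemigroup S] : Type _ :=
  Algebra.GrothendieckGroup (WithOne S)

namespace GroupOfFractions

section CommSemigroup

variable {S : Type*} [CommSemigroup S]

instance : CommGroup (GroupOfFractions S) :=
  inferInstanceAs (CommGroup (Algebra.GrothendieckGroup (WithOne S)))

/-- The canonical map of a commutative semigroup into its group of fractions. -/
def of : S →ₙ* GroupOfFractions S where
  toFun s := Algebra.GrothendieckGroup.of (s : WithOne S)
  map_mul' x y := by rw [WithOne.coe_mul, map_mul]; rfl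

theorem of_injective [IsCancelMul S] : Function.Injective (of : S → GroupOfFractions S) := by
  intro x y h
  obtain ⟨⟨c, _⟩, hc⟩ := (Localization.monoidOf (⊤ : Submonoid (WithOne S))).eq_iff_exists.1 h
  induction c with
  | one => exact WithOne.coe_injective (by simpa only [one_mul] using hc)
  | coe c => exact mul_left_cancel (WithOne.coe_injective hc)

theorem exists_eq_of_div_of [Nonempty S] (g : GroupOfFractions S) :
    ∃ a b : S, g = of b / of a := by
  let g' : Algebra.GrothendieckGroup (WithOne S) := g
  obtain ⟨⟨x, ⟨y, _⟩⟩, h⟩ := (Localization.monoidOf (⊤ : Submonoid (WithOne S))).surj g'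
  obtain ⟨s⟩ := ‹Nonempty S›
  have hmul_coe (x : WithOne S) : ∃ t : S, x * s = t := by
    induction x with
    | one => exact ⟨s, one_mul _⟩
    | coe x => exact ⟨x * s, rfl⟩
  obtain ⟨a, ha⟩ := hmul_coe y
  obtain ⟨b, hb⟩ := hmul_coe x
  refine ⟨a, b, eq_div_of_mul_eq' ?_⟩
  change g' * Algebra.GrothendieckGroup.of (a : WithOne S) =
    Algebra.GrothendieckGroup.of (b : WithOne S)
  rw [← ha, ← hb, map_mul, map_mul, ← mul_assoc]
  exact congrArg (· * _) h

end CommSemigroup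

section Order

variable {S : Type*} [CommSemigroup S] [IsCancelMul S] [PartialOrder S] [MulLeftMono S]
  [MulLeftReflectLE S]

theorem le_of_of_div_of_eq {a b c d : S} (h : of b / of a = of d / of c) (hab : a ≤ b) :
    c ≤ d := by
  rw [div_eq_div_iff_mul_eq_mul, ← map_mul, ← map_mul] at h
  refine le_of_mul_le_mul_left' (a := a) ?_
  rw [mul_comm a d, ← of_injective h]
  exact mul_le_mul_left hab c

variable [Nonempty S]

/-- The cone that extends the order of `S` to its group of fractions. -/
def cone (S : Type*) [CommSemigroup S] [IsCancelMul S] [PartialOrder S] [MulLeftMono S]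
    [MulLeftReflectLE S] [Nonempty S] : GroupCone (GroupOfFractions S) where
  carrier := {g | ∃ a b : S, a ≤ b ∧ g = of b / of a}
  one_mem' := by
    obtain ⟨a⟩ := ‹Nonempty S›
    exact ⟨a, a, le_rfl, (div_self' _).symm⟩
  mul_mem' := by
    rintro _ _ ⟨a, b, hab, rfl⟩ ⟨c, d, hcd, rfl⟩
    exact ⟨a * c, b * d, mul_le_mul' hab hcd, by rw [map_mul, map_mul, div_mul_div_comm]⟩
  eq_one_of_mem_of_inv_mem' := by
    rintro _ ⟨a, b, hab, rfl⟩ ⟨c, d, hcd, h⟩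
    rw [inv_div] at h
    rw [hab.antisymm (le_of_of_div_of_eq h.symm hcd), div_self']

instance : PartialOrder (GroupOfFractions S) := PartialOrder.mkOfGroupCone (cone S)

instance : IsOrderedMonoid (GroupOfFractions S) := IsOrderedMonoid.mkOfCone (cone S)

theorem of_le_of {a b : S} : of a ≤ of b ↔ a ≤ b :=
  ⟨fun ⟨_, _, hcd, h⟩ => le_of_of_div_of_eq h.symm hcd, fun h => ⟨a, b, h, rfl⟩⟩

theorem of_lt_of {a b : S} : of a < of b ↔ a < b :=
  lt_iff_lt_of_le_iff_le' of_le_of of_le_of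

theorem le_total (h : ∀ a b : S, a ≤ b ∨ b ≤ a) (x y : GroupOfFractions S) : x ≤ y ∨ y ≤ x := by
  obtain ⟨a, b, hab⟩ := exists_eq_of_div_of (y / x)
  refine (h a b).imp (fun hle => ⟨a, b, hle, hab⟩) fun hle => ⟨b, a, hle, ?_⟩
  rw [← inv_div, hab, inv_div]

end Order

section Semiring

variable {S : Type*} [Add S] [CommSemigroup S] [LeftDistribClass S] [IsCancelMul S]
  [SemilatticeSup S] [AddIsSup S] [Nonempty S]

theorem of_sup_le {x y : S} {g : GroupOfFractions S} :
    of (x ⊔ y) ≤ g ↔ of x ≤ g ∧ of y ≤ g := by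
  obtain ⟨a, b, rfl⟩ := exists_eq_of_div_of g
  simp only [le_div_iff_mul_le, ← map_mul, of_le_of, mul_comm _ a, mul_sup_of_addIsSup, sup_le_iff]

/-- `of x` is bounded by `of y` up to a power of `g`. -/
def IsDominated (g : GroupOfFractions S) (x y : S) : Prop :=
  ∃ k : ℕ, of x ≤ of y * g ^ k

namespace IsDominated

variable {g : GroupOfFractions S} {x y z t : S}

theorem trans (h : IsDominated g x y) (h' : IsDominated g y z) : IsDominated g x z := by
  obtain ⟨k, hk⟩ := h
  obtain ⟨l, hl⟩ := h'
  refine ⟨l + k, hk.trans ?_⟩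
  rw [pow_add, ← mul_assoc]
  exact mul_le_mul_left hl _

theorem mul (h : IsDominated g x y) (h' : IsDominated g z t) :
    IsDominated g (x * z) (y * t) := by
  obtain ⟨k, hk⟩ := h
  obtain ⟨l, hl⟩ := h'
  refine ⟨k + l, ?_⟩
  rw [map_mul, map_mul, pow_add, mul_mul_mul_comm]
  exact mul_le_mul' hk hl

theorem add (hg : 1 ≤ g) (h : IsDominated g x y) (h' : IsDominated g z t) :
    IsDominated g (x + z) (y + t) := by
  obtain ⟨k, hk⟩ := h
  obtain ⟨l, hl⟩ := h'
  rw [AddIsSup.add_eq_sup, AddIsSup.add_eq_sup]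
  exact ⟨k + l, of_sup_le.2
    ⟨hk.trans (mul_le_mul' (of_le_of.2 le_sup_left) (pow_le_pow_right' hg (Nat.le_add_right k l))),
      hl.trans (mul_le_mul' (of_le_of.2 le_sup_right)
        (pow_le_pow_right' hg (Nat.le_add_left l k)))⟩⟩

end IsDominated

/-- The congruence that identifies the elements of `S` in the same coset of the convex subgroup
generated by `g`. -/
def convexCon {g : GroupOfFractions S} (hg : 1 ≤ g) : RingCon S where
  r x y := IsDominated g x y ∧ IsDominated g y x
  iseqv :=
    { refl := fun _ => ⟨⟨0, by rw [pow_zero, mul_one]⟩, 0, by rw [pow_zero, mul_one]⟩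
      symm := And.symm
      trans := fun h h' => ⟨h.1.trans h'.1, h'.2.trans h.2⟩ }
  add' h h' := ⟨h.1.add hg h'.1, h.2.add hg h'.2⟩
  mul' h h' := ⟨h.1.mul h'.1, h.2.mul h'.2⟩

theorem le_of_sup_isDominated {x y : S} (h : IsDominated (of (x ⊔ y) / of y) (x ⊔ y) x) :
    y ≤ x := by
  obtain ⟨k, hk⟩ := h
  refine (le_sup_right : y ≤ x ⊔ y).trans (of_le_of.1 ?_)
  have hg : 1 ≤ of (x ⊔ y) / of y := one_le_div'.2 (of_le_of.2 le_sup_right)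
  induction k with
  | zero => simpa only [pow_zero, mul_one] using hk
  | succ k ih =>
    refine ih (of_sup_le.2 ⟨le_mul_of_one_le_right' (one_le_pow_of_one_le' hg k), ?_⟩)
    rw [pow_succ, ← mul_assoc, mul_div_assoc', le_div_iff_mul_le, mul_comm] at hk
    exact le_of_mul_le_mul_right' hk

end Semiring

end GroupOfFractions

section RealEmbedding

open GroupOfFractions

variable {S : Type*} [Add S] [CommSemigroup S] [LeftDistribClass S] [IsCancelMul S]
  [SemilatticeSup S] [AddIsSup S] [Nonempty S]

theorem CongruenceSimple.isDominated (hS : CongruenceSimple S) {a b : S} (hab : a < b) (x y : S) :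
    IsDominated (of b / of a) x y := by
  have hg : 1 ≤ of b / of a := one_le_div'.2 (of_le_of.2 hab.le)
  have hrel : convexCon hg a b :=
    ⟨⟨0, by simpa only [pow_zero, mul_one] using of_le_of.2 hab.le⟩,
      ⟨1, by rw [pow_one, mul_div_cancel]⟩⟩
  exact (hS.rel_of_ne _ hab.ne hrel x y).1

theorem CongruenceSimple.le_total (hS : CongruenceSimple S) (x y : S) : x ≤ y ∨ y ≤ x := by
  rcases (le_sup_right : y ≤ x ⊔ y).eq_or_lt with h | h
  · exact Or.inl (sup_eq_right.1 h.symm)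
  · exact Or.inr (le_of_sup_isDominated (hS.isDominated h _ _))

theorem CongruenceSimple.mulArchimedean (hS : CongruenceSimple S) :
    MulArchimedean (GroupOfFractions S) where
  arch g h hh := by
    obtain ⟨x, y, rfl⟩ := exists_eq_of_div_of g
    obtain ⟨a, b, rfl⟩ := exists_eq_of_div_of h
    obtain ⟨k, hk⟩ := hS.isDominated (of_lt_of.1 (one_lt_div'.1 hh)) y x
    exact ⟨k, div_le_iff_le_mul'.2 hk⟩

theorem CongruenceSimple.exists_isMaxPlusEmbedding (hS : CongruenceSimple S) :
    ∃ φ : S → ℝ, IsMaxPlusEmbedding φ := by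
  let _ : LinearOrder (GroupOfFractions S) :=
    { (inferInstance : PartialOrder (GroupOfFractions S)) with
      le_total := GroupOfFractions.le_total hS.le_total
      toDecidableLE := Classical.decRel _ }
  have : MulArchimedean (GroupOfFractions S) := hS.mulArchimedean
  obtain ⟨f, hf⟩ := Archimedean.exists_orderAddMonoidHom_real_injective
    (Additive (GroupOfFractions S))
  have hmono : Monotone fun x : S => f (Additive.ofMul (of x)) := fun x y h =>
    f.monotone' (of_le_of.2 h)
  refine ⟨fun x => f (Additive.ofMul (of x)), ?_, fun x y => ?_, fun x y => ?_⟩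
  · exact hf.comp (Additive.ofMul.injective.comp of_injective)
  · rw [AddIsSup.add_eq_sup]
    rcases hS.le_total x y with h | h
    · rw [sup_eq_right.2 h, max_eq_right (hmono h)]
    · rw [sup_eq_left.2 h, max_eq_left (hmono h)]
  · simp only [map_mul, ofMul_mul, map_add]

theorem CongruenceSimple.exists_ringEquiv_maxPlus {S : Type*} [AddCommMagma S]
    [CommSemigroup S] [LeftDistribClass S] [IsCancelMul S] [SemilatticeSup S] [AddIsSup S]
    (hS : CongruenceSimple S) :
    ∃ A : PlainSubsemiring MaxPlus, (∃ x ∈ A, 0 < x.toReal) ∧ (∃ x ∈ A, x.toReal < 0) ∧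
      Nonempty (S ≃+* A) := by
  have := hS.nontrivial
  obtain ⟨φ, hφ⟩ := hS.exists_isMaxPlusEmbedding
  obtain ⟨p, hp⟩ := hφ.exists_pos hS
  obtain ⟨q, hq⟩ := hφ.exists_neg hS
  refine ⟨hφ.range, ⟨hφ.ringEquivRange p, SetLike.coe_mem _, ?_⟩,
    ⟨hφ.ringEquivRange q, SetLike.coe_mem _, ?_⟩, ⟨hφ.ringEquivRange⟩⟩
  · rwa [hφ.toReal_ringEquivRange]
  · rwa [hφ.toReal_ringEquivRange]

end RealEmbedding

theorem mainTheorem4 {S : Type*} [Nonempty S] [AddCommSemigroup S] [CommSemigroup S]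
    [LeftDistribClass S] [RightDistribClass S] (hidem : ∀ a : S, a + a = a)
    (n : ℕ) [NeZero n] (hn : 2 ≤ n) :
    List.TFAE [
      CongruenceSimple (MatrixSemiring n S),
      CongruenceSimple S ∧ (Set.univ * Set.univ : Set S).encard ≠ 1 ∧
        ¬ ∃ w : S, IsBiAbsorbing w,
      Nonempty (S ≃+* TwoLattice) ∨
        ∃ A : PlainSubsemiring MaxPlus,
          (∃ x ∈ A, 0 < MaxPlus.toReal x) ∧ (∃ x ∈ A, MaxPlus.toReal x < 0) ∧
          Nonempty (S ≃+* A)] := by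
  let _ := naturalOrder hidem
  have : AddIsSup S := ⟨fun _ _ => rfl⟩
  tfae_have 1 → 2 := fun h => ⟨h.of_matrixSemiring,
    encard_univ_mul_univ_ne_one_of_matrixSemiring h hn,
    not_exists_isBiAbsorbing_of_matrixSemiring h hn⟩
  tfae_have 2 → 3 := by
    rintro ⟨hS, hSS, hbi⟩
    rcases hS.isCancelMul_or_nonempty_ringEquiv_twoLattice hSS hbi with hcancel | he
    exacts [Or.inr hS.exists_ringEquiv_maxPlus, Or.inl he]
  tfae_have 3 → 1 := by
    rintro (⟨⟨e⟩⟩ | ⟨A, ⟨x, hxA, hx⟩, ⟨y, hyA, hy⟩, ⟨e⟩⟩)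
    · exact congruenceSimple_matrixSemiring_of_twoLattice e n
    · refine (isMaxPlusEmbedding_toReal_comp e).congruenceSimple_matrixSemiring
        (p := e.symm ⟨x, hxA⟩) (q := e.symm ⟨y, hyA⟩) ?_ ?_ n <;>
      rwa [e.apply_symm_apply]
  tfae_finish
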